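/- \textbf{Channel model.} For every codeword length $n\ge 1$ let $K_n\ge 1$ be an integer, let $h^{(n)}=(h^{(n)}_k)_{k=0}^{K_n-1}$ be real taps with $h^{(n)}_0\,h^{(n)}_{K_n-1}\neq 0$, put $\bar n=n+K_n-1$, and let $\Sigma_n\in\mathbb{R}^{\bar n\times\bar n}$ be a covariance matrix (symmetric positive semidefinite). When $x\in\mathbb{R}^n$ is sent over the Gaussian channel $\mathcal{G}$ with $K_n$-tap inter-symbol interference and colored noise, the output is $Y=H_nx+Z\in\mathbb{R}^{\bar n}$, where $H_n=[h^{(n)}_{i-j}]\in\mathbb{R}^{\bar n\times n}$ is the Toeplitz convolution matrix ($h^{(n)}_k=0$ for $k<0$ or $k\ge K_n$) and $Z\sim\mathcal{N}(0,\Sigma_n)$. \textbf{Codes and capacity.} Let $P_{\max}>0$. A deterministic identification (DI) code of length $n$ with $M$ messages and error bounds $e_1,e_2$ consists of codewords $c_1,\dots,c_M\in[-P_{\max},P_{\max}]^n$ and measurable, possibly overlapping, decoding regions $D_1,\dots,D_M\subseteq\mathbb{R}^{\bar n}$ such that $\Pr(Y\notin D_i\mid x=c_i)\le e_1$ for all $i$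 and $\Pr(Y\in D_j\mid x=c_i)\le e_2$ for all $i\ne j$. A rate $R>0$ is achievable if for all $e_1,e_2>0$ and all sufficiently large $n$ there is such a code with $M=\lceil 2^{(n\log_2 n)R}\rceil$. The DI capacity $\mathbb{C}_{\mathrm I}(\mathcal{G})$ is the supremum of all achievable rates. \textbf{Theorem.} Let $\kappa,\mu\ge 0$ with $\kappa+\mu<1/2$, and let $K_n=n^{\kappa}$, rounded up or down to an integer. Assume that, with constants that do not depend on $n$, (C1) the taps are bounded: there is $L<\infty$ with $|h^{(n)}_k|\le L$ for all $n\ge1$ and $0\le k<K_n$; (C2) the discrete-time Fourier transform is bounded away from zero: there is $c>0$ such that $\bigl|\sum_{k=0}^{K_n-1}h^{(n)}_k e^{-\mathrm{i}\omega k}\bigr|\ge c$ for all $n\ge1$ and $\omega\in[-\pi,\pi]$; (C3) the smallest and largest singular values of $\Sigma_n$ satisfy $\sigma_{\min}(\Sigma_n)\in\Omega(n^{-\mu})$ and $\sigma_{\max}(\Sigma_n)\in O(n^{\mu/2})$. Then \[ \frac{1-2(\kappa+\mu)}{4}\;\le\;\mathbb{C}_{\mathrm I}(\mathcal{G})\;\le\;1+\kappa+\frac{\mu}{2}.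 \] -/

import Mathlib

open Filter Asymptotics MeasureTheory ProbabilityTheory Matrix

noncomputable section

/-- A discrete-time Gaussian channel with inter-symbol interference and colored noise: for every
codeword length `n ≥ 1` a number `K n ≥ 1` of taps, the taps `h n 0, …, h n (K n - 1)` of the
impulse response (the values `h n k` with `k ≥ K n` are never used) with nonzero first and last
tap, and the covariance matrix of the noise, whose size is the output length `n + K n - 1`. -/
structure ColoredISIChannel where
  /-- number of taps -/
  K : ℕ → ℕ
  /-- taps of the channel impulse response -/
  h : ℕ → ℕ → ℝ
  /-- covariance matrix of the noise -/
  Sigma : (n : ℕ) → Matrix (Fin (n + K n - 1)) (Fin (n + K n - 1)) ℝ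
  K_pos : ∀ n, 1 ≤ n → 1 ≤ K n
  first_tap : ∀ n, 1 ≤ n → h n 0 ≠ 0
  last_tap : ∀ n, 1 ≤ n → h n (K n - 1) ≠ 0
  posSemidef : ∀ n, 1 ≤ n → (Sigma n).PosSemidef

namespace ColoredISIChannel

variable (G : ColoredISIChannel)

/-- Length of the output vector for codewords of length `n`. -/
abbrev outLen (n : ℕ) : ℕ := n + G.K n - 1

/-- The Toeplitz convolution matrix, with entry `h_{i-j}` where `h_k = 0` unless `0 ≤ k < K`. -/
def convMatrix (n : ℕ) : Matrix (Fin (G.outLen n)) (Fin n) ℝ :=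
  Matrix.of fun i j =>
    if (j : ℕ) ≤ (i : ℕ) ∧ (i : ℕ) - (j : ℕ) < G.K n then G.h n ((i : ℕ) - (j : ℕ)) else 0

/-- The law of the output `Y = H x + Z`, `Z ∼ N(0, Σ)`, when the codeword `x` is sent. -/
def outputLaw (n : ℕ) (x : Fin n → ℝ) : Measure (EuclideanSpace ℝ (Fin (G.outLen n))) :=
  multivariateGaussian (WithLp.toLp 2 (G.convMatrix n *ᵥ x)) (G.Sigma n)

/-- The discrete-time Fourier transform of the impulse response. -/
def dtft (n : ℕ) (ω : ℝ) : ℂ :=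
  ∑ k ∈ Finset.range (G.K n), (G.h n k : ℂ) * Complex.exp (-(Complex.I * ω * k))

/-- The largest singular value of the covariance matrix. -/
def sigmaMax (n : ℕ) : ℝ := (Matrix.toEuclideanLin (G.Sigma n)).singularValues 0

/-- The smallest singular value of the covariance matrix (the last one of `outLen n` many, as
singular values are listed in decreasing order from index `0`). -/
def sigmaMin (n : ℕ) : ℝ := (Matrix.toEuclideanLin (G.Sigma n)).singularValues (G.outLen n - 1)

/-- A deterministic identification code with `M` messages and codeword length `n` under the peak
power constraint `P`, with type I errors at most `e₁` and type II errors at most `e₂`. The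
decoding regions may overlap. -/
structure DICode (P : ℝ) (n M : ℕ) (e₁ e₂ : ℝ) where
  /-- codewords -/
  codeword : Fin M → Fin n → ℝ
  /-- decoding regions -/
  region : Fin M → Set (EuclideanSpace ℝ (Fin (G.outLen n)))
  measurableSet_region : ∀ i, MeasurableSet (region i)
  peak_power : ∀ i t, |codeword i t| ≤ P
  typeI_le : ∀ i, (G.outputLaw n (codeword i)).real (region i)ᶜ ≤ e₁
  typeII_le : ∀ i j, i ≠ j → (G.outputLaw n (codeword i)).real (region j) ≤ e₂

/-- `R > 0` is achievable if for all `e₁, e₂ > 0` and all large `n` there is a code with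
`2 ^ ((n log₂ n) R)` messages (rounded up to an integer). -/
def Achievable (P R : ℝ) : Prop :=
  0 < R ∧ ∀ e₁ > 0, ∀ e₂ > 0, ∀ᶠ n : ℕ in atTop,
    Nonempty (G.DICode P n ⌈(2 : ℝ) ^ (n * Real.logb 2 n * R)⌉₊ e₁ e₂)

/-- The deterministic identification capacity: the supremum of all achievable rates. -/
def capacity (P : ℝ) : EReal := sSup {r : EReal | ∃ R : ℝ, G.Achievable P R ∧ r = (R : EReal)}

end ColoredISIChannel

end

/-! Whitening by the square root of the covariance turns the channel into a shift of a standard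
Gaussian vector: two codewords `x`, `y` act like shifts differing by `u`, where `noiseMap u = H (x -
y)`. By Parseval, `H` stretches lengths by factors between the extreme values of the frequency
response, so `‖u‖` is controlled from both sides by `‖x - y‖`, the tap bounds and the singular
values of the covariance.

Converse: if both errors are at most 1/4, some event changes its Gaussian probability by at least
1/2 under the shift `u`. A second-moment bound on the likelihood ratio forces `‖u‖ ^ 2 ≥ 1/16`
(`norm_shift_ge_of_stdGaussian_separated`). Codewords then differ in some coordinate by order `n ^
(-(1/2 + κ + μ/2))`, and counting grid cells in the cube (`card_le_of_separated`) gives `R ≤ 1/2 + κ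
+ μ/2`, which is stronger than the stated bound.

Achievability: a receiver testing message `j` accepts when the whitened residual has squared norm at
most its dimension plus `δ`. By Chebyshev this works once `δ` exceeds the fluctuation `√n` by a
power of `n` and `‖u‖ ^ 2 ≥ 3 δ` (`stdGaussian_norm_shift_sq_le_le`). A Gilbert–Varshamov code over
about `n ^ α` equispaced letters has squared distances of order `n ^ (1 - 2 α)` and, up to a small
loss, rate `α`. Dividing by the noise level `n ^ (μ/2)` leaves more than `√n` whenever `α < (1 -
μ)/4`, which covers all the rates needed. -/

/-! ### Gaussian shifts and likelihood ratios -/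

section GaussianShift

lemma gaussianReal_eq_withDensity_exp (v : ℝ) :
    gaussianReal v 1 = (gaussianReal 0 1).withDensity
      (fun x => ENNReal.ofReal (Real.exp (v * x - v ^ 2 / 2))) := by
  rw [gaussianReal_of_var_ne_zero _ one_ne_zero, gaussianReal_of_var_ne_zero _ one_ne_zero,
    ← withDensity_mul _ (measurable_gaussianPDF _ _) (by fun_prop)]
  congr 1
  ext x
  simp only [gaussianPDF_def, Pi.mul_apply]
  rw [← ENNReal.ofReal_mul (gaussianPDFReal_nonneg _ _ _)]
  congr 1
  simp only [gaussianPDFReal_def]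
  rw [mul_assoc _ (Real.exp _), ← Real.exp_add]
  congr 2
  simp
  ring

variable {ι : Type*} [Fintype ι]

lemma pi_gaussianReal_eq_withDensity_exp (v : ι → ℝ) :
    Measure.pi (fun i => gaussianReal (v i) 1) =
      (Measure.pi fun _ : ι => gaussianReal 0 1).withDensity
        (fun x => ENNReal.ofReal (Real.exp (∑ i, (v i * x i - v i ^ 2 / 2)))) := by
  refine Measure.pi_eq fun s hs => ?_
  rw [withDensity_apply _ (MeasurableSet.univ_pi hs),
    ← lintegral_indicator (MeasurableSet.univ_pi hs)]
  set f : ι → ℝ → ENNReal := fun i =>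
    (s i).indicator fun x => ENNReal.ofReal (Real.exp (v i * x - v i ^ 2 / 2)) with hf
  have hfm : ∀ i, Measurable (f i) := fun i => Measurable.indicator (by fun_prop) (hs i)
  have key : ∀ x : ι → ℝ, (Set.univ.pi s).indicator
      (fun x => ENNReal.ofReal (Real.exp (∑ i, (v i * x i - v i ^ 2 / 2)))) x
      = ∏ i, f i (x i) := by
    intro x
    by_cases hx : x ∈ Set.univ.pi s
    · rw [Set.indicator_of_mem hx, Real.exp_sum, ENNReal.ofReal_prod_of_nonneg
        (fun i _ => (Real.exp_pos _).le)]
      exact Finset.prod_congr rfl fun i _ => by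
        simp only [hf]; rw [Set.indicator_of_mem (hx i trivial)]
    · rw [Set.indicator_of_notMem hx]
      simp only [Set.mem_univ_pi, not_forall] at hx
      obtain ⟨i, hi⟩ := hx
      symm
      refine Finset.prod_eq_zero (Finset.mem_univ i) ?_
      simp only [hf]; rw [Set.indicator_of_notMem hi]
  simp_rw [key]
  have hind := iIndepFun_pi (μ := fun _ : ι => gaussianReal 0 1) (X := f)
    (fun i => (hfm i).aemeasurable)
  have h2 := lintegral_prod_eq_prod_lintegral_of_indepFun Finset.univ _ hind
    (fun i => (hfm i).comp (measurable_pi_apply i))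
  refine h2.trans ?_
  refine Finset.prod_congr rfl fun i _ => ?_
  rw [gaussianReal_eq_withDensity_exp (v i), withDensity_apply _ (hs i), ← lintegral_indicator (hs i)]
  exact lintegral_map (μ := Measure.pi fun _ : ι => gaussianReal 0 1) (hfm i)
    (measurable_pi_apply i) |>.symm.trans (by
      rw [(measurePreserving_eval (fun _ : ι => gaussianReal 0 1) i).map_eq])

lemma lintegral_exp_pi_gaussianReal (v : ι → ℝ) :
    ∫⁻ x, ENNReal.ofReal (Real.exp (∑ i, (v i * x i - v i ^ 2 / 2)))
      ∂(Measure.pi fun _ : ι => gaussianReal 0 1) = 1 := by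
  rw [← setLIntegral_univ, ← withDensity_apply _ MeasurableSet.univ,
    ← pi_gaussianReal_eq_withDensity_exp]
  exact measure_univ

lemma integrable_exp_pi_gaussianReal (v : ι → ℝ) :
    Integrable (fun x : ι → ℝ => Real.exp (∑ i, (v i * x i - v i ^ 2 / 2)))
      (Measure.pi fun _ : ι => gaussianReal 0 1) := by
  refine ⟨Measurable.aestronglyMeasurable (by fun_prop), ?_⟩
  rw [hasFiniteIntegral_iff_ofReal (Eventually.of_forall fun x => (Real.exp_pos _).le),
    lintegral_exp_pi_gaussianReal]
  exact ENNReal.one_lt_top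

lemma integral_exp_pi_gaussianReal (v : ι → ℝ) :
    ∫ x, Real.exp (∑ i, (v i * x i - v i ^ 2 / 2))
      ∂(Measure.pi fun _ : ι => gaussianReal 0 1) = 1 := by
  rw [integral_eq_lintegral_of_nonneg_ae (Eventually.of_forall fun x => (Real.exp_pos _).le)
    (integrable_exp_pi_gaussianReal v).1, lintegral_exp_pi_gaussianReal]
  rfl

/-- Completing the square: the squared density for shift `v` is a multiple of the density for shift
`2 v`, so its integral can be read off. -/
lemma sq_exp_shift_density (v x : ι → ℝ) :
    Real.exp (∑ i, (v i * x i - v i ^ 2 / 2)) ^ 2 =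
      Real.exp (∑ i, v i ^ 2) * Real.exp (∑ i, ((2 * v i) * x i - (2 * v i) ^ 2 / 2)) := by
  rw [← Real.exp_add, ← Real.exp_nat_mul, ← Finset.sum_add_distrib, Finset.mul_sum]
  congr 1
  refine Finset.sum_congr rfl fun i _ => ?_
  push_cast
  ring

/-- Shifting a standard Gaussian by a short vector changes probabilities only a little. -/
lemma pi_gaussianReal_shift_le (v : ι → ℝ) {B : Set (ι → ℝ)} (hB : MeasurableSet B) :
    (Measure.pi fun i => gaussianReal (v i) 1).real B ≤
      (Measure.pi fun _ : ι => gaussianReal 0 1).real B +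
        (1 / 8 + 2 * (Real.exp (∑ i, v i ^ 2) - 1)) := by
  set γ := Measure.pi fun _ : ι => gaussianReal 0 1 with hγ
  set f : (ι → ℝ) → ℝ := fun x => Real.exp (∑ i, (v i * x i - v i ^ 2 / 2)) with hf
  have hfi : Integrable f γ := integrable_exp_pi_gaussianReal v
  have hf2 : ∀ x, f x ^ 2 = Real.exp (∑ i, v i ^ 2) *
    Real.exp (∑ i, ((2 * v i) * x i - (2 * v i) ^ 2 / 2)) := sq_exp_shift_density v
  have hf2i : Integrable (fun x => f x ^ 2) γ := by
    simp_rw [hf2]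
    exact (integrable_exp_pi_gaussianReal (fun i => 2 * v i)).const_mul _
  have hf2int : ∫ x, f x ^ 2 ∂γ = Real.exp (∑ i, v i ^ 2) := by
    simp_rw [hf2]
    rw [integral_const_mul, integral_exp_pi_gaussianReal (fun i => 2 * v i), mul_one]
  have hfint : ∫ x, f x ∂γ = 1 := integral_exp_pi_gaussianReal v
  have h1 : (Measure.pi fun i => gaussianReal (v i) 1).real B = ∫ x in B, f x ∂γ := by
    rw [measureReal_def, pi_gaussianReal_eq_withDensity_exp, withDensity_apply _ hB,
      integral_eq_lintegral_of_nonneg_ae (Eventually.of_forall fun x => (Real.exp_pos _).le)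
        hfi.1.restrict]
  have h2 : γ.real B = ∫ x in B, (1 : ℝ) ∂γ := by simp
  have hsub : Integrable (fun x => f x - 1) γ := hfi.sub (integrable_const _)
  have hbi : Integrable (fun x => (1 / 8 : ℝ) + 2 * (f x ^ 2 - 2 * f x + 1)) γ :=
    (integrable_const _).add
      (((hf2i.sub (hfi.const_mul 2)).add (integrable_const _)).const_mul 2)
  have h3 : ∫ x in B, f x ∂γ - ∫ x in B, (1 : ℝ) ∂γ ≤
      ∫ x, ((1 / 8 : ℝ) + 2 * (f x ^ 2 - 2 * f x + 1)) ∂γ := by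
    rw [← integral_sub hfi.integrableOn (integrable_const _)]
    -- Pointwise `t ≤ 1/8 + 2 t ^ 2` with `t = f x - 1`, which is `(4 t - 1) ^ 2 ≥ 0`. The right
    -- side is nonnegative, so the integral may be extended from `B` to the whole space.
    calc ∫ x in B, (f x - 1) ∂γ
        ≤ ∫ x in B, ((1 / 8 : ℝ) + 2 * (f x ^ 2 - 2 * f x + 1)) ∂γ :=
          integral_mono hsub.integrableOn hbi.integrableOn fun x => by
            simp only; nlinarith [sq_nonneg (4 * (f x - 1) - 1)]
      _ ≤ _ := setIntegral_le_integral hbi (Eventually.of_forall fun x => by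
            simp only [Pi.zero_apply]; nlinarith [sq_nonneg (f x - 1)])
  have h4 : ∫ x, ((1 / 8 : ℝ) + 2 * (f x ^ 2 - 2 * f x + 1)) ∂γ =
      1 / 8 + 2 * (Real.exp (∑ i, v i ^ 2) - 1) := by
    have e : ∀ x, (1 / 8 : ℝ) + 2 * (f x ^ 2 - 2 * f x + 1) = 17 / 8 + (2 * f x ^ 2 - 4 * f x) :=
      fun x => by ring
    have hi : Integrable (fun x => 2 * f x ^ 2 - 4 * f x) γ :=
      (hf2i.const_mul 2).sub (hfi.const_mul 4)
    simp_rw [e]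
    rw [integral_add (integrable_const _) hi,
      integral_sub (hf2i.const_mul 2) (hfi.const_mul 4), integral_const_mul, integral_const_mul,
      hf2int, hfint]
    simp
    ring
  rw [h1, h2]
  linarith

/-- Shifting a standard Gaussian by a short vector changes probabilities only a little. -/
lemma stdGaussian_shift_le (v : EuclideanSpace ℝ ι) {B : Set (EuclideanSpace ℝ ι)}
    (hB : MeasurableSet B) :
    (stdGaussian (EuclideanSpace ℝ ι)).real ((fun x => v + x) ⁻¹' B) ≤
      (stdGaussian (EuclideanSpace ℝ ι)).real B +
        (1 / 8 + 2 * (Real.exp (‖v‖ ^ 2) - 1)) := by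
  have hm : Measurable (WithLp.toLp 2 : (ι → ℝ) → EuclideanSpace ℝ ι) := by fun_prop
  have hB' : MeasurableSet ((fun x : EuclideanSpace ℝ ι => v + x) ⁻¹' B) :=
    (measurable_const_add v) hB
  have h := pi_gaussianReal_shift_le (fun i => v i) (hm hB)
  rw [← EuclideanSpace.real_norm_sq_eq] at h
  rw [← map_pi_eq_stdGaussian, map_measureReal_apply hm hB', map_measureReal_apply hm hB]
  refine le_trans (le_of_eq ?_) h
  have hmap : (Measure.pi fun _ : ι => gaussianReal 0 1).map (fun x i => v i + x i) =
      Measure.pi fun i => gaussianReal (v i) 1 := by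
    rw [Measure.pi_map_pi (f := fun i x => v i + x) (fun i => by fun_prop)]
    simp [gaussianReal_map_const_add]
  rw [← hmap, map_measureReal_apply (by fun_prop) (hm hB)]
  rfl

/-- A shift with `‖v‖ ^ 2 < 1/16` changes probabilities by at most `1/8 + 2/15 < 1/2`. -/
lemma norm_shift_ge_of_stdGaussian_separated (v : EuclideanSpace ℝ ι)
    {B : Set (EuclideanSpace ℝ ι)} (hB : MeasurableSet B)
    (h : (stdGaussian (EuclideanSpace ℝ ι)).real B + 1 / 2 ≤
      (stdGaussian (EuclideanSpace ℝ ι)).real ((fun x => v + x) ⁻¹' B)) :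
    1 / 16 ≤ ‖v‖ ^ 2 := by
  by_contra! hv
  have h1 := stdGaussian_shift_le v hB
  have h2 : Real.exp (‖v‖ ^ 2) ≤ 1 / (1 - ‖v‖ ^ 2) :=
    Real.exp_bound_div_one_sub_of_interval (by positivity) (by linarith)
  have h3 : 1 / (1 - ‖v‖ ^ 2) ≤ 16 / 15 := by
    rw [div_le_div_iff₀ (by linarith) (by norm_num)]
    linarith
  linarith

end GaussianShift

/-! ### Concentration of Gaussian norms -/

section ChiSquare

variable {ι : Type*} [Fintype ι]

/-- The squared norm of a standard Gaussian vector concentrates around the dimension. -/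
lemma stdGaussian_abs_norm_sq_sub_card_ge_le {δ : ℝ} (hδ : 0 < δ) :
    (stdGaussian (EuclideanSpace ℝ ι)).real {x | δ ≤ |‖x‖ ^ 2 - Fintype.card ι|} ≤
      Fintype.card ι * Var[fun x : ℝ => x ^ 2; gaussianReal 0 1] / δ ^ 2 := by
  have hm : Measurable (WithLp.toLp 2 : (ι → ℝ) → EuclideanSpace ℝ ι) := by fun_prop
  have hset : MeasurableSet {x : EuclideanSpace ℝ ι | δ ≤ |‖x‖ ^ 2 - Fintype.card ι|} :=
    measurableSet_le measurable_const (by fun_prop)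
  rw [← map_pi_eq_stdGaussian, map_measureReal_apply hm hset]
  set γ := Measure.pi fun _ : ι => gaussianReal 0 1
  have hsq : MemLp (fun x : ℝ => x ^ 2) 2 (gaussianReal 0 1) := by
    have h4 : MemLp (id : ℝ → ℝ) 4 (gaussianReal 0 1) :=
      memLp_id_gaussianReal' (μ := 0) (v := 1) 4 (by simp)
    refine (memLp_two_iff_integrable_sq (by fun_prop)).2 ?_
    refine (h4.integrable_norm_pow (p := 4) (by norm_num)).congr (Eventually.of_forall fun x => ?_)
    simp only [id, Real.norm_eq_abs]
    rw [← pow_mul, Even.pow_abs (by decide)]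
  have hL : ∀ i, MemLp (fun x : ι → ℝ => x i ^ 2) 2 γ := fun i =>
    hsq.comp_measurePreserving (measurePreserving_eval (fun _ : ι => gaussianReal 0 1) i)
  have hmean1 : ∫ x : ℝ, x ^ 2 ∂(gaussianReal 0 1) = 1 := by
    have := variance_id_gaussianReal (μ := 0) (v := 1)
    rw [variance_eq_integral measurable_id.aemeasurable] at this
    simpa using this
  have hmean : ∫ x : ι → ℝ, ∑ i, x i ^ 2 ∂γ = Fintype.card ι := by
    rw [integral_finsetSum _ fun i _ => (hL i).integrable one_le_two]
    have : ∀ i, ∫ x : ι → ℝ, x i ^ 2 ∂γ = 1 := fun i => by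
      rw [← hmean1, ← (measurePreserving_eval (fun _ : ι => gaussianReal 0 1) i).map_eq,
        integral_map (measurable_pi_apply i).aemeasurable (by fun_prop)]
    simp [this]
  have hvar : Var[∑ i, fun x : ι → ℝ => x i ^ 2; γ] =
      Fintype.card ι * Var[fun x : ℝ => x ^ 2; gaussianReal 0 1] := by
    rw [variance_sum_pi (X := fun _ x => x ^ 2) fun _ => hsq]
    simp
  have hsumeq : (∑ i, fun x : ι → ℝ => x i ^ 2) = fun x => ∑ i, x i ^ 2 := by
    ext; simp
  rw [hsumeq] at hvar
  have hch := meas_ge_le_variance_div_sq (μ := γ) (X := fun x : ι → ℝ => ∑ i, x i ^ 2)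
    (memLp_finsetSum _ fun i _ => hL i) hδ
  rw [hmean, hvar] at hch
  refine ENNReal.toReal_le_of_le_ofReal
    (div_nonneg (mul_nonneg (Nat.cast_nonneg _) (variance_nonneg _ _)) (sq_nonneg _)) ?_
  refine le_trans (le_of_eq ?_) hch
  congr 1
  ext x
  simp [EuclideanSpace.real_norm_sq_eq]

lemma stdGaussian_abs_inner_ge_le (u : EuclideanSpace ℝ ι) {a : ℝ} (ha : 0 < a) :
    (stdGaussian (EuclideanSpace ℝ ι)).real {x | a ≤ |inner ℝ u x|} ≤ ‖u‖ ^ 2 / a ^ 2 := by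
  have h := meas_ge_le_variance_div_sq (μ := stdGaussian (EuclideanSpace ℝ ι))
    (X := innerSL ℝ u) (IsGaussian.memLp_dual _ (innerSL ℝ u) 2 (by simp)) ha
  rw [integral_strongDual_stdGaussian, variance_dual_stdGaussian, innerSL_apply_norm] at h
  refine ENNReal.toReal_le_of_le_ofReal (by positivity) (le_trans (le_of_eq ?_) h)
  simp

/-- A standard Gaussian shifted by a long vector rarely has norm close to typical. -/
lemma stdGaussian_norm_shift_sq_le_le (u : EuclideanSpace ℝ ι) {δ : ℝ} (hδ : 0 < δ)
    (hu : 3 * δ ≤ ‖u‖ ^ 2) :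
    (stdGaussian (EuclideanSpace ℝ ι)).real {x | ‖u + x‖ ^ 2 ≤ Fintype.card ι + δ} ≤
      Fintype.card ι * Var[fun x : ℝ => x ^ 2; gaussianReal 0 1] / δ ^ 2 + 12 / δ := by
  have hu0 : 0 < ‖u‖ ^ 2 := by linarith
  calc _ ≤ (stdGaussian (EuclideanSpace ℝ ι)).real
        ({x | δ ≤ |‖x‖ ^ 2 - Fintype.card ι|} ∪ {x | ‖u‖ ^ 2 / 6 ≤ |inner ℝ u x|}) := by
        refine measureReal_mono ?_
        intro x hx
        simp only [Set.mem_ofPred_eq, Set.mem_union] at hx ⊢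
        -- Off both bad events, `‖u + x‖ ^ 2` exceeds `(2/3) ‖u‖ ^ 2 + card ι - δ`, hence `card ι +
        -- δ`.
        by_contra! hcon
        have h1 := neg_lt_of_abs_lt hcon.1
        have h2 := neg_lt_of_abs_lt hcon.2
        rw [norm_add_sq_real] at hx
        linarith
    _ ≤ _ := measureReal_union_le _ _
    _ ≤ _ := by
        refine add_le_add (stdGaussian_abs_norm_sq_sub_card_ge_le hδ) ?_
        refine (stdGaussian_abs_inner_ge_le u (by positivity)).trans ?_
        rw [div_le_div_iff₀ (by positivity) hδ]
        nlinarith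

end ChiSquare

/-! ### Quadratic forms and extreme singular values -/

section SingularValueBounds

open Module

variable {E F : Type*} [NormedAddCommGroup E] [InnerProductSpace ℝ E] [FiniteDimensional ℝ E]
  [NormedAddCommGroup F] [InnerProductSpace ℝ F] [FiniteDimensional ℝ F]

lemma LinearMap.IsSymmetric.inner_apply_eq_sum_eigenvalues {T : E →ₗ[ℝ] E} (hT : T.IsSymmetric)
    {n : ℕ} (hn : finrank ℝ E = n) (x : E) :
    inner ℝ x (T x) =
      ∑ i, hT.eigenvalues hn i * inner ℝ (hT.eigenvectorBasis hn i) x ^ 2 := by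
  rw [← (hT.eigenvectorBasis hn).sum_inner_mul_inner]
  refine Finset.sum_congr rfl fun i _ => ?_
  rw [← hT, hT.apply_eigenvectorBasis, real_inner_smul_left, real_inner_comm]
  simp
  ring

lemma LinearMap.IsSymmetric.mul_norm_sq_le_inner {T : E →ₗ[ℝ] E} (hT : T.IsSymmetric)
    {n : ℕ} (hn : finrank ℝ E = n) {c : ℝ} (hc : ∀ i, c ≤ hT.eigenvalues hn i) (x : E) :
    c * ‖x‖ ^ 2 ≤ inner ℝ x (T x) := by
  rw [hT.inner_apply_eq_sum_eigenvalues hn, ← (hT.eigenvectorBasis hn).sum_sq_inner_right,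
    Finset.mul_sum]
  exact Finset.sum_le_sum fun i _ => mul_le_mul_of_nonneg_right (hc i) (sq_nonneg _)

lemma LinearMap.IsSymmetric.inner_le_mul_norm_sq {T : E →ₗ[ℝ] E} (hT : T.IsSymmetric)
    {n : ℕ} (hn : finrank ℝ E = n) {c : ℝ} (hc : ∀ i, hT.eigenvalues hn i ≤ c) (x : E) :
    inner ℝ x (T x) ≤ c * ‖x‖ ^ 2 := by
  rw [hT.inner_apply_eq_sum_eigenvalues hn, ← (hT.eigenvectorBasis hn).sum_sq_inner_right,
    Finset.mul_sum]
  exact Finset.sum_le_sum fun i _ => mul_le_mul_of_nonneg_right (hc i) (sq_nonneg _)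

lemma LinearMap.inner_adjoint_comp_self (T : E →ₗ[ℝ] F) (x : E) :
    inner ℝ x ((LinearMap.adjoint T ∘ₗ T) x) = ‖T x‖ ^ 2 := by
  rw [LinearMap.comp_apply, LinearMap.adjoint_inner_right, real_inner_self_eq_norm_sq]

lemma LinearMap.norm_apply_le_singularValues_zero (T : E →ₗ[ℝ] F) (x : E) :
    ‖T x‖ ≤ T.singularValues 0 * ‖x‖ := by
  refine le_of_sq_le_sq ?_ (mul_nonneg (T.singularValues_nonneg _) (norm_nonneg _))
  rw [← T.inner_adjoint_comp_self, mul_pow]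
  refine T.isSymmetric_adjoint_comp_self.inner_le_mul_norm_sq rfl (fun i => ?_) x
  rw [← T.sq_singularValues_fin rfl i]
  exact pow_le_pow_left₀ (T.singularValues_nonneg _) (T.singularValues_antitone (Nat.zero_le _)) 2

lemma LinearMap.singularValues_mul_norm_le (T : E →ₗ[ℝ] F) (x : E) :
    T.singularValues (finrank ℝ E - 1) * ‖x‖ ≤ ‖T x‖ := by
  refine le_of_sq_le_sq ?_ (norm_nonneg _)
  rw [← T.inner_adjoint_comp_self, mul_pow]
  refine T.isSymmetric_adjoint_comp_self.mul_norm_sq_le_inner rfl (fun i => ?_) x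
  rw [← T.sq_singularValues_fin rfl i]
  exact pow_le_pow_left₀ (T.singularValues_nonneg _)
    (T.singularValues_antitone (by have := i.isLt; omega)) 2

/-- For a unit eigenvector `e` of a positive operator, `‖T e‖` is the eigenvalue itself, so every
eigenvalue dominates the least singular value. -/
lemma LinearMap.IsPositive.singularValues_mul_norm_sq_le {T : E →ₗ[ℝ] E} (hT : T.IsPositive)
    (x : E) : T.singularValues (finrank ℝ E - 1) * ‖x‖ ^ 2 ≤ inner ℝ x (T x) := by
  refine hT.isSymmetric.mul_norm_sq_le_inner rfl (fun i => ?_) x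
  have h := T.singularValues_mul_norm_le (hT.isSymmetric.eigenvectorBasis rfl i)
  rw [hT.isSymmetric.apply_eigenvectorBasis, norm_smul,
    (hT.isSymmetric.eigenvectorBasis rfl).norm_eq_one] at h
  simpa [abs_of_nonneg (hT.nonneg_eigenvalues rfl i)] using h

lemma LinearMap.inner_apply_le_singularValues_zero (T : E →ₗ[ℝ] E) (x : E) :
    inner ℝ x (T x) ≤ T.singularValues 0 * ‖x‖ ^ 2 := by
  calc inner ℝ x (T x) ≤ ‖x‖ * ‖T x‖ := real_inner_le_norm _ _
    _ ≤ ‖x‖ * (T.singularValues 0 * ‖x‖) := by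
        gcongr; exact T.norm_apply_le_singularValues_zero x
    _ = _ := by ring

end SingularValueBounds

/-! ### Square root of the covariance -/

section MatrixSqrt

variable {ι : Type*} [Fintype ι] [DecidableEq ι]

open scoped MatrixOrder in
lemma Matrix.PosSemidef.norm_sqrt_apply_sq {S : Matrix ι ι ℝ} (hS : S.PosSemidef)
    (x : EuclideanSpace ℝ ι) :
    ‖toEuclideanCLM (𝕜 := ℝ) (CFC.sqrt S) x‖ ^ 2 = inner ℝ x (toEuclideanLin S x) := by
  have hsa : IsSelfAdjoint (toEuclideanCLM (𝕜 := ℝ) (CFC.sqrt S)) :=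
    (CFC.sqrt_nonneg S).isSelfAdjoint.map _
  rw [← real_inner_self_eq_norm_sq, ← ContinuousLinearMap.adjoint_inner_right, hsa.adjoint_eq,
    ← ContinuousLinearMap.comp_apply, ← ContinuousLinearMap.mul_def, ← map_mul,
    CFC.sqrt_mul_sqrt_self _ hS.nonneg]
  rfl

end MatrixSqrt

/-! ### Parseval's identity -/

section TrigonometricSum

/-- The trigonometric sum with the entries of a real vector as coefficients. -/
noncomputable def trigSum {m : ℕ} (a : Fin m → ℝ) (ω : ℝ) : ℂ :=
  ∑ j, (a j : ℂ) * Complex.exp (-(Complex.I * ω * (j : ℕ)))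

lemma continuous_trigSum {m : ℕ} (a : Fin m → ℝ) : Continuous (trigSum a) := by
  unfold trigSum
  fun_prop

lemma integral_exp_int_mul_I (k : ℤ) :
    ∫ ω in (-Real.pi)..Real.pi, Complex.exp (Complex.I * k * ω) =
      if k = 0 then 2 * (Real.pi : ℂ) else 0 := by
  split_ifs with h
  · subst h
    simp
    ring
  · have hc : Complex.I * (k : ℂ) ≠ 0 := mul_ne_zero Complex.I_ne_zero (by exact_mod_cast h)
    rw [integral_exp_mul_complex hc]
    have : Complex.exp (Complex.I * k * (Real.pi : ℂ)) =
        Complex.exp (Complex.I * k * ((-Real.pi : ℝ) : ℂ)) := by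
      rw [Complex.exp_eq_exp_iff_exists_int]
      exact ⟨k, by push_cast; ring⟩
    rw [this, sub_self, zero_div]

/-- Parseval's identity for trigonometric sums. -/
lemma integral_norm_sq_trigSum {m : ℕ} (a : Fin m → ℝ) :
    ∫ ω in (-Real.pi)..Real.pi, ‖trigSum a ω‖ ^ 2 = 2 * Real.pi * ∑ j, a j ^ 2 := by
  have h1 : ∀ ω : ℝ, ((‖trigSum a ω‖ ^ 2 : ℝ) : ℂ) =
      ∑ j, ∑ k, ((a j * a k : ℝ) : ℂ) *
        Complex.exp (Complex.I * (((k : ℕ) - (j : ℕ) : ℤ) : ℂ) * ω) := by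
    intro ω
    push_cast
    rw [← Complex.mul_conj', trigSum, map_sum, Finset.sum_mul_sum]
    refine Finset.sum_congr rfl fun j _ => Finset.sum_congr rfl fun k _ => ?_
    rw [map_mul, Complex.conj_ofReal, ← Complex.exp_conj]
    simp only [map_neg, map_mul, Complex.conj_I, Complex.conj_ofReal, Complex.conj_natCast]
    rw [mul_mul_mul_comm, ← Complex.exp_add]
    congr 2
    ring
  have h2 : ((∫ ω in (-Real.pi)..Real.pi, ‖trigSum a ω‖ ^ 2 : ℝ) : ℂ) =
      ((2 * Real.pi * ∑ j, a j ^ 2 : ℝ) : ℂ) := by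
    rw [← intervalIntegral.integral_ofReal]
    simp_rw [h1]
    rw [intervalIntegral.integral_finsetSum fun j _ =>
      Continuous.intervalIntegrable (by fun_prop) _ _]
    have h3 : ∀ j : Fin m, ∫ ω in (-Real.pi)..Real.pi, ∑ k, ((a j * a k : ℝ) : ℂ) *
        Complex.exp (Complex.I * (((k : ℕ) - (j : ℕ) : ℤ) : ℂ) * ω) =
        2 * (Real.pi : ℂ) * (a j : ℂ) ^ 2 := by
      intro j
      rw [intervalIntegral.integral_finsetSum fun k _ =>
        Continuous.intervalIntegrable (by fun_prop) _ _]
      rw [Finset.sum_eq_single j]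
      · rw [intervalIntegral.integral_const_mul, integral_exp_int_mul_I]
        simp
        ring
      · intro k _ hk
        have : ((k : ℕ) - (j : ℕ) : ℤ) ≠ 0 := fun h => hk (Fin.ext (by omega))
        rw [intervalIntegral.integral_const_mul, integral_exp_int_mul_I, if_neg this, mul_zero]
      · simp
    simp_rw [h3]
    push_cast
    rw [Finset.mul_sum]
  exact_mod_cast h2

end TrigonometricSum

/-! ### Convolution and noise operators -/

namespace ColoredISIChannel

variable (G : ColoredISIChannel)

/-- Column `j` is the tap sequence delayed by `j`. The output length `n + K - 1` leaves room for all
taps, so none is cut off. -/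
lemma sum_convMatrix_mul_exp {n : ℕ} (j : Fin n) (ω : ℝ) :
    ∑ i, (G.convMatrix n i j : ℂ) * Complex.exp (-(Complex.I * ω * (i : ℕ))) =
      G.dtft n ω * Complex.exp (-(Complex.I * ω * (j : ℕ))) := by
  set f : ℕ → ℂ := fun i =>
    ((if (j : ℕ) ≤ i ∧ i - (j : ℕ) < G.K n then G.h n (i - (j : ℕ)) else 0 : ℝ) : ℂ) *
      Complex.exp (-(Complex.I * ω * i)) with hf
  have h1 : ∑ i, (G.convMatrix n i j : ℂ) * Complex.exp (-(Complex.I * ω * (i : ℕ))) =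
      ∑ i : Fin (G.outLen n), f i := rfl
  rw [h1, Fin.sum_univ_eq_sum_range f, dtft, Finset.sum_mul]
  symm
  have hj := j.isLt
  refine Finset.sum_of_injOn (fun k => k + (j : ℕ)) (fun a _ b _ h => by simpa using h) ?_ ?_ ?_
  · intro k hk
    simp only [Finset.coe_range, Set.mem_Iio] at hk ⊢
    simp only [outLen]
    omega
  · intro i hi hi'
    simp only [Finset.coe_range, Set.mem_image, Set.mem_Iio, not_exists, not_and] at hi'
    have : ¬ ((j : ℕ) ≤ i ∧ i - (j : ℕ) < G.K n) := fun h =>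
      hi' (i - j) h.2 (Nat.sub_add_cancel h.1)
    simp [hf, this]
  · intro k hk
    have hk' : k < G.K n := by simpa using hk
    simp only [hf, Nat.le_add_left, Nat.add_sub_cancel, hk', and_self, if_true]
    rw [mul_assoc, ← Complex.exp_add]
    push_cast
    congr 2
    ring

lemma trigSum_convMatrix_mulVec {n : ℕ} (x : Fin n → ℝ) (ω : ℝ) :
    trigSum (G.convMatrix n *ᵥ x) ω = G.dtft n ω * trigSum x ω := by
  have h : ∀ i, (((G.convMatrix n *ᵥ x) i : ℝ) : ℂ) = ∑ j, (G.convMatrix n i j : ℂ) * x j := by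
    intro i
    simp [Matrix.mulVec, dotProduct]
  simp only [trigSum, h, Finset.sum_mul, Finset.mul_sum]
  rw [Finset.sum_comm]
  refine Finset.sum_congr rfl fun j _ => ?_
  have := G.sum_convMatrix_mul_exp j ω
  rw [mul_left_comm, ← this, Finset.mul_sum]
  refine Finset.sum_congr rfl fun i _ => ?_
  ring

lemma norm_sq_toLp_eq {m : ℕ} (a : Fin m → ℝ) :
    ‖(WithLp.toLp 2 a : EuclideanSpace ℝ (Fin m))‖ ^ 2 = ∑ j, a j ^ 2 := by
  rw [EuclideanSpace.real_norm_sq_eq]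

lemma two_pi_mul_norm_sq_convMatrix_mulVec {n : ℕ} (x : Fin n → ℝ) :
    2 * Real.pi * ‖(WithLp.toLp 2 (G.convMatrix n *ᵥ x) : EuclideanSpace ℝ _)‖ ^ 2 =
      ∫ ω in (-Real.pi)..Real.pi, ‖G.dtft n ω‖ ^ 2 * ‖trigSum x ω‖ ^ 2 := by
  rw [norm_sq_toLp_eq, ← integral_norm_sq_trigSum]
  simp_rw [trigSum_convMatrix_mulVec, norm_mul, mul_pow]

lemma continuous_dtft (n : ℕ) : Continuous (G.dtft n) := by
  unfold dtft
  fun_prop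

lemma mul_norm_le_norm_convMatrix_mulVec {n : ℕ} {c : ℝ} (hc : 0 ≤ c)
    (h : ∀ ω ∈ Set.Icc (-Real.pi) Real.pi, c ≤ ‖G.dtft n ω‖) (x : Fin n → ℝ) :
    c * ‖(WithLp.toLp 2 x : EuclideanSpace ℝ _)‖ ≤
      ‖(WithLp.toLp 2 (G.convMatrix n *ᵥ x) : EuclideanSpace ℝ _)‖ := by
  refine le_of_sq_le_sq ?_ (norm_nonneg _)
  have hpi := Real.pi_pos
  refine le_of_mul_le_mul_left (a := 2 * Real.pi) ?_ (by positivity)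
  rw [two_pi_mul_norm_sq_convMatrix_mulVec, mul_pow, mul_left_comm, norm_sq_toLp_eq,
    ← integral_norm_sq_trigSum, ← intervalIntegral.integral_const_mul]
  have := G.continuous_dtft n
  have := continuous_trigSum x
  refine intervalIntegral.integral_mono_on (by linarith)
    (Continuous.intervalIntegrable (by fun_prop) _ _)
    (Continuous.intervalIntegrable (by fun_prop) _ _) fun ω hω => ?_
  gcongr
  exact h ω hω

lemma norm_convMatrix_mulVec_le {n : ℕ} {c : ℝ} (hc : 0 ≤ c)
    (h : ∀ ω, ‖G.dtft n ω‖ ≤ c) (x : Fin n → ℝ) :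
    ‖(WithLp.toLp 2 (G.convMatrix n *ᵥ x) : EuclideanSpace ℝ _)‖ ≤
      c * ‖(WithLp.toLp 2 x : EuclideanSpace ℝ _)‖ := by
  refine le_of_sq_le_sq ?_ (by positivity)
  have hpi := Real.pi_pos
  refine le_of_mul_le_mul_left (a := 2 * Real.pi) ?_ (by positivity)
  rw [two_pi_mul_norm_sq_convMatrix_mulVec, mul_pow, mul_left_comm, norm_sq_toLp_eq,
    ← integral_norm_sq_trigSum, ← intervalIntegral.integral_const_mul]
  have := G.continuous_dtft n
  have := continuous_trigSum x
  refine intervalIntegral.integral_mono_on (by linarith)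
    (Continuous.intervalIntegrable (by fun_prop) _ _)
    (Continuous.intervalIntegrable (by fun_prop) _ _) fun ω hω => ?_
  gcongr
  exact h ω

lemma norm_dtft_le {n : ℕ} {L : ℝ} (hL : ∀ k < G.K n, |G.h n k| ≤ L) (ω : ℝ) :
    ‖G.dtft n ω‖ ≤ G.K n * L := by
  unfold dtft
  refine (norm_sum_le_of_le _ (n := fun _ => L) fun k hk => ?_).trans (by simp)
  have : -(Complex.I * ω * k) = ((-(ω * k) : ℝ) : ℂ) * Complex.I := by push_cast; ring
  rw [norm_mul, this, Complex.norm_exp_ofReal_mul_I, mul_one, Complex.norm_real]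
  exact hL k (Finset.mem_range.1 hk)

open scoped MatrixOrder in
/-- The square root of the noise covariance, as an operator. -/
noncomputable def noiseMap (n : ℕ) :
    EuclideanSpace ℝ (Fin (G.outLen n)) →L[ℝ] EuclideanSpace ℝ (Fin (G.outLen n)) :=
  toEuclideanCLM (𝕜 := ℝ) (CFC.sqrt (G.Sigma n))

lemma norm_noiseMap_sq_le {n : ℕ} (hn : 1 ≤ n) (x : EuclideanSpace ℝ (Fin (G.outLen n))) :
    ‖G.noiseMap n x‖ ^ 2 ≤ G.sigmaMax n * ‖x‖ ^ 2 := by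
  rw [noiseMap, (G.posSemidef n hn).norm_sqrt_apply_sq]
  exact LinearMap.inner_apply_le_singularValues_zero _ x

lemma sigmaMin_mul_norm_sq_le {n : ℕ} (hn : 1 ≤ n) (x : EuclideanSpace ℝ (Fin (G.outLen n))) :
    G.sigmaMin n * ‖x‖ ^ 2 ≤ ‖G.noiseMap n x‖ ^ 2 := by
  rw [noiseMap, (G.posSemidef n hn).norm_sqrt_apply_sq]
  have h := (Matrix.isPositive_toEuclideanLin_iff.2
    (G.posSemidef n hn)).singularValues_mul_norm_sq_le x
  rwa [finrank_euclideanSpace_fin] at h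

/-- Expresses all output laws through one standard Gaussian, so that codewords enter only as shifts.
-/
lemma outputLaw_real_apply (n : ℕ) (x : Fin n → ℝ) {B : Set (EuclideanSpace ℝ (Fin (G.outLen n)))}
    (hB : MeasurableSet B) :
    (G.outputLaw n x).real B = (stdGaussian (EuclideanSpace ℝ (Fin (G.outLen n)))).real
      {z | WithLp.toLp 2 (G.convMatrix n *ᵥ x) + G.noiseMap n z ∈ B} :=
  map_measureReal_apply (f := fun z => WithLp.toLp 2 (G.convMatrix n *ᵥ x) + G.noiseMap n z)
    (by fun_prop) hB

instance isProbabilityMeasure_outputLaw (n : ℕ) (x : Fin n → ℝ) :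
    IsProbabilityMeasure (G.outputLaw n x) := by
  unfold outputLaw
  infer_instance

end ColoredISIChannel

/-! ### Packing bounds for codes -/

section Packing

/-- The number of words within Hamming distance `m` of a given word. -/
lemma card_hammingDist_le_le {n q : ℕ} (hq : 1 ≤ q) (m : ℕ) (w : Fin n → Fin q) :
    (Finset.univ.filter fun x : Fin n → Fin q => hammingDist w x ≤ m).card ≤ 2 ^ n * q ^ m := by
  classical
  set T : Finset (Finset (Fin n)) := Finset.univ.filter fun S => S.card ≤ m
  set box : Finset (Fin n) → Finset (Fin n → Fin q) := fun S =>
    Fintype.piFinset fun i => if i ∈ S then Finset.univ else {w i} with hbox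
  -- A word in the ball agrees with `w` outside a set `S` of at most `m` positions; there are at
  -- most `2 ^ n` such sets.
  have hsub : (Finset.univ.filter fun x : Fin n → Fin q => hammingDist w x ≤ m) ⊆ T.biUnion box := by
    intro x hx
    simp only [Finset.mem_filter, Finset.mem_univ, true_and] at hx
    refine Finset.mem_biUnion.2 ⟨Finset.univ.filter fun i => w i ≠ x i, by
      simpa [T, hammingDist] using hx, ?_⟩
    refine Fintype.mem_piFinset.2 fun i => ?_
    by_cases h : w i = x i <;> simp [h]
  have hcard : ∀ S ∈ T, (box S).card ≤ q ^ m := by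
    intro S hS
    have : (box S).card = q ^ S.card := by
      rw [hbox, Fintype.card_piFinset]
      have : ∀ i, (if i ∈ S then (Finset.univ : Finset (Fin q)) else {w i}).card =
          if i ∈ S then q else 1 := fun i => by split_ifs <;> simp
      simp_rw [this]
      rw [Finset.prod_ite]
      simp
    rw [this]
    exact Nat.pow_le_pow_right hq (by simpa [T] using hS)
  calc _ ≤ (T.biUnion box).card := Finset.card_le_card hsub
    _ ≤ T.card * q ^ m := Finset.card_biUnion_le_card_mul _ _ _ hcard
    _ ≤ 2 ^ n * q ^ m := by
        gcongr
        exact (Finset.card_le_univ _).trans (by simp)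

/-- A Gilbert–Varshamov bound. -/
lemma exists_code_hammingDist_gt {n q m M : ℕ} (hq : 1 ≤ q)
    (hM : M * (2 ^ n * q ^ m) ≤ q ^ n) :
    ∃ f : Fin M → Fin n → Fin q, ∀ i j, i ≠ j → m < hammingDist (f i) (f j) := by
  classical
  obtain ⟨C, hC, hmax⟩ := (Finset.univ.filter fun C : Finset (Fin n → Fin q) =>
    ∀ x ∈ C, ∀ y ∈ C, x ≠ y → m < hammingDist x y).exists_max_image Finset.card ⟨∅, by simp⟩
  simp only [Finset.mem_filter, Finset.mem_univ, true_and] at hC hmax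
  -- A word outside all the balls could be added to the code, contradicting maximality.
  have hcover : (Finset.univ : Finset (Fin n → Fin q)) ⊆
      C.biUnion fun w => Finset.univ.filter fun x => hammingDist w x ≤ m := by
    intro x _
    by_contra hx
    simp only [Finset.mem_biUnion, Finset.mem_filter, Finset.mem_univ, true_and, not_exists,
      not_and, not_le] at hx
    have hxC : x ∉ C := fun h => by simpa using hx x h
    have := hmax (insert x C) (by
      intro a ha b hb hab
      rcases Finset.mem_insert.1 ha with ha | ha <;> rcases Finset.mem_insert.1 hb with hb | hb
      · exact absurd (ha.trans hb.symm) hab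
      · rw [hammingDist_comm, ha]; exact hx b hb
      · rw [hb]; exact hx a ha
      · exact hC a ha b hb hab)
    rw [Finset.card_insert_of_notMem hxC] at this
    omega
  have h1 : q ^ n ≤ C.card * (2 ^ n * q ^ m) := by
    calc q ^ n = (Finset.univ : Finset (Fin n → Fin q)).card := by simp
      _ ≤ _ := Finset.card_le_card hcover
      _ ≤ _ := Finset.card_biUnion_le_card_mul _ _ _ fun w _ => card_hammingDist_le_le hq m w
  have hMC : M ≤ C.card := Nat.le_of_mul_le_mul_right (hM.trans h1) (by positivity)
  refine ⟨fun i => (C.equivFin.symm (Fin.castLE hMC i) : Fin n → Fin q), fun i j hij => ?_⟩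
  refine hC _ (Subtype.prop _) _ (Subtype.prop _) fun h => hij ?_
  simpa using C.equivFin.symm.injective (Subtype.ext h)

/-- Points of a cube that pairwise differ by at least `r` in some coordinate are few. -/
lemma card_le_of_separated {n M : ℕ} {P r : ℝ} (hr : 0 < r) (c : Fin M → Fin n → ℝ)
    (hP : ∀ i t, |c i t| ≤ P) (hsep : ∀ i j, i ≠ j → ∃ t, r ≤ |c i t - c j t|) :
    M ≤ (⌊2 * P / r⌋₊ + 1) ^ n := by
  have hpos : ∀ i t, 0 ≤ (c i t + P) / r := fun i t =>
    div_nonneg (by linarith [neg_le_of_abs_le (hP i t)]) hr.le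
  -- Index of the grid cell of side `r`; points in a common cell differ by less than `r` in every
  -- coordinate.
  set f : Fin M → Fin n → Fin (⌊2 * P / r⌋₊ + 1) := fun i t =>
    ⟨⌊(c i t + P) / r⌋₊, Nat.lt_succ_of_le (Nat.floor_le_floor (by
      gcongr; linarith [le_of_abs_le (hP i t)]))⟩ with hf
  have hinj : Function.Injective f := by
    intro i j hij
    by_contra hne
    obtain ⟨t, ht⟩ := hsep i j hne
    have h1 : ⌊(c i t + P) / r⌋₊ = ⌊(c j t + P) / r⌋₊ := congrArg Fin.val (congrFun hij t)
    have a1 := Nat.floor_le (hpos i t)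
    have a2 := Nat.lt_floor_add_one ((c i t + P) / r)
    have b1 := Nat.floor_le (hpos j t)
    have b2 := Nat.lt_floor_add_one ((c j t + P) / r)
    rw [h1] at a1 a2
    have h2 : |(c i t + P) / r - (c j t + P) / r| < 1 := abs_lt.2 ⟨by linarith, by linarith⟩
    rw [← sub_div, abs_div, abs_of_pos hr, div_lt_one hr] at h2
    have : c i t + P - (c j t + P) = c i t - c j t := by ring
    rw [this] at h2
    linarith
  simpa using Fintype.card_le_of_injective f hinj

end Packing

/-! ### Separation of codewords and construction of codes -/

namespace ColoredISIChannel

variable {G : ColoredISIChannel} {n : ℕ}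

lemma noiseMap_injective (hn : 1 ≤ n) (hs : 0 < G.sigmaMin n) :
    Function.Injective (G.noiseMap n) := by
  refine (injective_iff_map_eq_zero _).2 fun x hx => ?_
  have h := G.sigmaMin_mul_norm_sq_le hn x
  rw [hx, norm_zero] at h
  have : ‖x‖ ^ 2 ≤ 0 := by
    by_contra! hc
    have := mul_pos hs hc
    norm_num at h
    linarith
  exact norm_eq_zero.1 (pow_eq_zero_iff two_ne_zero |>.1 (le_antisymm this (sq_nonneg _)))

lemma exists_noiseMap_eq (hn : 1 ≤ n) (hs : 0 < G.sigmaMin n)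
    (y : EuclideanSpace ℝ (Fin (G.outLen n))) : ∃ u, G.noiseMap n u = y :=
  LinearMap.injective_iff_surjective (f := (G.noiseMap n).toLinearMap) |>.1
    (noiseMap_injective hn hs) y

lemma toLp_convMatrix_mulVec_sub (x y : Fin n → ℝ) :
    (WithLp.toLp 2 (G.convMatrix n *ᵥ x) - WithLp.toLp 2 (G.convMatrix n *ᵥ y) :
      EuclideanSpace ℝ (Fin (G.outLen n))) = WithLp.toLp 2 (G.convMatrix n *ᵥ (x - y)) := by
  rw [Matrix.mulVec_sub]; rfl

/-- Codewords of an identification code with small errors are separated. -/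
lemma DICode.sigmaMin_le {P : ℝ} {M : ℕ} (C : G.DICode P n M (1 / 4) (1 / 4)) (hn : 1 ≤ n)
    (hs : 0 < G.sigmaMin n) {L : ℝ} (hL0 : 0 ≤ L) (hL : ∀ k < G.K n, |G.h n k| ≤ L)
    {i j : Fin M} (hij : i ≠ j) :
    G.sigmaMin n / 16 ≤ (G.K n * L) ^ 2 * ∑ t, (C.codeword i t - C.codeword j t) ^ 2 := by
  obtain ⟨v, hv⟩ := exists_noiseMap_eq hn hs (WithLp.toLp 2 (G.convMatrix n *ᵥ C.codeword i) -
    WithLp.toLp 2 (G.convMatrix n *ᵥ C.codeword j))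
  have hD := C.measurableSet_region i
  -- The same region `i` is tested under both inputs: probability at least 3/4 under `i`, at most
  -- 1/4 under `j`.
  have h1 := C.typeI_le i
  have h2 := C.typeII_le j i hij.symm
  rw [probReal_compl_eq_one_sub hD, G.outputLaw_real_apply n _ hD] at h1
  rw [G.outputLaw_real_apply n _ hD] at h2
  set B : Set (EuclideanSpace ℝ (Fin (G.outLen n))) :=
    {z | WithLp.toLp 2 (G.convMatrix n *ᵥ C.codeword j) + G.noiseMap n z ∈ C.region i} with hB
  have hBm : MeasurableSet B :=
    (show Measurable fun z => WithLp.toLp 2 (G.convMatrix n *ᵥ C.codeword j) + G.noiseMap n z by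
      fun_prop) hD
  have hshift : (fun z => v + z) ⁻¹' B =
      {z | WithLp.toLp 2 (G.convMatrix n *ᵥ C.codeword i) + G.noiseMap n z ∈ C.region i} := by
    ext z
    simp only [hB, Set.mem_preimage, Set.mem_ofPred_eq, map_add, hv]
    rw [← add_assoc, add_sub_cancel]
  have h3 := norm_shift_ge_of_stdGaussian_separated v hBm (by rw [hshift]; linarith)
  have h4 := G.sigmaMin_mul_norm_sq_le hn v
  rw [hv, toLp_convMatrix_mulVec_sub] at h4
  have h5 := G.norm_convMatrix_mulVec_le (by positivity) (G.norm_dtft_le hL)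
    (C.codeword i - C.codeword j)
  have h6 := pow_le_pow_left₀ (norm_nonneg _) h5 2
  rw [mul_pow, norm_sq_toLp_eq (C.codeword i - C.codeword j)] at h6
  simp only [Pi.sub_apply] at h6
  nlinarith

/-- The number of messages of an identification code with small errors. -/
lemma DICode.card_le {P : ℝ} {M : ℕ} (C : G.DICode P n M (1 / 4) (1 / 4)) (hn : 1 ≤ n)
    (hs : 0 < G.sigmaMin n) {L : ℝ} (hL0 : 0 ≤ L) (hL : ∀ k < G.K n, |G.h n k| ≤ L)
    {r : ℝ} (hr : 0 < r) (hrs : (G.K n * L) ^ 2 * (n * r ^ 2) ≤ G.sigmaMin n / 16) :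
    M ≤ (⌊2 * P / r⌋₊ + 1) ^ n := by
  refine card_le_of_separated hr C.codeword C.peak_power fun i j hij => ?_
  by_contra! hcon
  have h1 := C.sigmaMin_le hn hs hL0 hL hij
  have hlt : ∑ t, (C.codeword i t - C.codeword j t) ^ 2 < n * r ^ 2 := by
    have : ∑ _t : Fin n, r ^ 2 = n * r ^ 2 := by simp
    rw [← this]
    refine Finset.sum_lt_sum_of_nonempty ⟨⟨0, hn⟩, Finset.mem_univ _⟩ fun t _ => ?_
    rw [← sq_abs]
    exact pow_lt_pow_left₀ (hcon t) (abs_nonneg _) two_ne_zero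
  have hK : 0 < (G.K n * L) ^ 2 := by
    by_contra! h0
    have h00 : (G.K n * L) ^ 2 = 0 := le_antisymm h0 (sq_nonneg _)
    rw [h00, zero_mul] at h1
    linarith
  have := mul_lt_mul_of_pos_left hlt hK
  linarith

/-- Well separated codewords are identified by thresholding the norm of the whitened output. -/
lemma nonempty_DICode_of_separated {P e₁ e₂ c₀ b δ D : ℝ} {M : ℕ} (hn : 1 ≤ n)
    (hs : 0 < G.sigmaMin n) (hc₀ : 0 ≤ c₀)
    (hdtft : ∀ ω ∈ Set.Icc (-Real.pi) Real.pi, c₀ ≤ ‖G.dtft n ω‖)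
    (hb : 0 < b) (hσ : G.sigmaMax n ≤ b) (hδ : 0 < δ) (c : Fin M → Fin n → ℝ)
    (hP : ∀ i t, |c i t| ≤ P) (hD : 3 * δ * b ≤ c₀ ^ 2 * D)
    (hsep : ∀ i j, i ≠ j → D ≤ ∑ t, (c i t - c j t) ^ 2)
    (he₁ : G.outLen n * Var[fun x : ℝ => x ^ 2; gaussianReal 0 1] / δ ^ 2 ≤ e₁)
    (he₂ : G.outLen n * Var[fun x : ℝ => x ^ 2; gaussianReal 0 1] / δ ^ 2 + 12 / δ ≤ e₂) :
    Nonempty (G.DICode P n M e₁ e₂) := by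
  set ball : Set (EuclideanSpace ℝ (Fin (G.outLen n))) := {z | ‖z‖ ^ 2 ≤ G.outLen n + δ} with hball
  set out : Fin M → EuclideanSpace ℝ (Fin (G.outLen n)) → EuclideanSpace ℝ (Fin (G.outLen n)) :=
    fun i z => WithLp.toLp 2 (G.convMatrix n *ᵥ c i) + G.noiseMap n z with hout
  have hinj := noiseMap_injective hn hs
  have hcomp : IsCompact ball := by
    -- Compactness makes the decoding regions, continuous images of the ball, closed and hence
    -- measurable.
    refine Metric.isCompact_of_isClosed_isBounded
      (isClosed_le (by fun_prop) continuous_const) ?_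
    refine (Metric.isBounded_closedBall (x := 0) (r := √(G.outLen n + δ))).subset fun z hz => ?_
    rw [mem_closedBall_zero_iff]
    exact Real.le_sqrt_of_sq_le hz
  have hmeas : ∀ i, MeasurableSet (out i '' ball) := fun i =>
    (hcomp.image (by fun_prop)).measurableSet
  refine ⟨⟨c, fun i => out i '' ball, hmeas, hP, fun i => ?_, fun i j hij => ?_⟩⟩
  · rw [G.outputLaw_real_apply n _ (hmeas i).compl]
    have h := stdGaussian_abs_norm_sq_sub_card_ge_le (ι := Fin (G.outLen n)) hδ
    rw [Fintype.card_fin] at h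
    refine le_trans (measureReal_mono fun z hz => ?_) (h.trans he₁)
    have hz' : z ∉ ball := fun hzb => hz ⟨z, hzb, rfl⟩
    simp only [hball, Set.mem_ofPred_eq, not_le] at hz' ⊢
    exact (by linarith : δ ≤ ‖z‖ ^ 2 - G.outLen n).trans (le_abs_self _)
  · rw [G.outputLaw_real_apply n _ (hmeas j)]
    obtain ⟨u, hu⟩ := exists_noiseMap_eq hn hs (WithLp.toLp 2 (G.convMatrix n *ᵥ c i) -
      WithLp.toLp 2 (G.convMatrix n *ᵥ c j))
    have hu3 : 3 * δ ≤ ‖u‖ ^ 2 := by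
      have h1 := G.norm_noiseMap_sq_le hn u
      rw [hu, toLp_convMatrix_mulVec_sub] at h1
      have h2 := pow_le_pow_left₀ (by positivity)
        (G.mul_norm_le_norm_convMatrix_mulVec hc₀ hdtft (c i - c j)) 2
      rw [mul_pow, norm_sq_toLp_eq (c i - c j)] at h2
      simp only [Pi.sub_apply] at h2
      have h3 := mul_le_mul_of_nonneg_left (hsep i j hij) (sq_nonneg c₀)
      have h4 := mul_le_mul_of_nonneg_right hσ (sq_nonneg ‖u‖)
      exact le_of_mul_le_mul_right (by linarith) hb
    have h := stdGaussian_norm_shift_sq_le_le u hδ hu3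
    rw [Fintype.card_fin] at h
    refine le_trans (measureReal_mono fun z hz => ?_) (h.trans he₂)
    obtain ⟨w, hw, hwz⟩ := hz
    have : w = u + z := hinj (by
      rw [map_add, hu, sub_add_eq_add_sub, eq_sub_iff_add_eq, add_comm]
      exact hwz)
    rw [this] at hw
    exact hw

/-- Identification codes from words over a `q`-letter alphabet in the interval `[0, P]`. -/
lemma nonempty_DICode {P e₁ e₂ c₀ b δ : ℝ} {M q m : ℕ} (hn : 1 ≤ n) (hP : 0 < P)
    (hs : 0 < G.sigmaMin n) (hc₀ : 0 ≤ c₀)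
    (hdtft : ∀ ω ∈ Set.Icc (-Real.pi) Real.pi, c₀ ≤ ‖G.dtft n ω‖)
    (hb : 0 < b) (hσ : G.sigmaMax n ≤ b) (hδ : 0 < δ) (hq : 1 ≤ q)
    (hM : M * (2 ^ n * q ^ m) ≤ q ^ n) (hD : 3 * δ * b ≤ c₀ ^ 2 * ((P / q) ^ 2 * m))
    (he₁ : G.outLen n * Var[fun x : ℝ => x ^ 2; gaussianReal 0 1] / δ ^ 2 ≤ e₁)
    (he₂ : G.outLen n * Var[fun x : ℝ => x ^ 2; gaussianReal 0 1] / δ ^ 2 + 12 / δ ≤ e₂) :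
    Nonempty (G.DICode P n M e₁ e₂) := by
  obtain ⟨f, hf⟩ := exists_code_hammingDist_gt hq hM
  have hq0 : (0 : ℝ) < q := by exact_mod_cast hq
  refine nonempty_DICode_of_separated hn hs hc₀ hdtft hb hσ hδ
    (fun i t => P / q * ((f i t : ℕ) : ℝ)) (fun i t => ?_) hD (fun i j hij => ?_) he₁ he₂
  · rw [abs_of_nonneg (by positivity), div_mul_eq_mul_div, div_le_iff₀ hq0]
    have : ((f i t : ℕ) : ℝ) ≤ q := by exact_mod_cast (f i t).isLt.le
    gcongr
  -- Distinct integer letters differ by at least one, so squared distance dominates Hamming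
  -- distance.
  · have h1 : (m : ℝ) ≤ ∑ t, (((f i t : ℕ) : ℝ) - ((f j t : ℕ) : ℝ)) ^ 2 := by
      calc (m : ℝ) ≤ hammingDist (f i) (f j) := by exact_mod_cast (hf i j hij).le
        _ = ∑ t, if f i t ≠ f j t then (1 : ℝ) else 0 := by
            rw [Finset.sum_boole]
            rfl
        _ ≤ _ := by
            refine Finset.sum_le_sum fun t _ => ?_
            split_ifs with h
            · have h2 : ((f i t : ℕ) : ℤ) - ((f j t : ℕ) : ℤ) ≠ 0 := fun h0 =>
                h (Fin.ext (by omega))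
              have h3 : (1 : ℤ) ≤ (((f i t : ℕ) : ℤ) - ((f j t : ℕ) : ℤ)) ^ 2 := by
                have := sq_pos_of_ne_zero h2
                omega
              exact_mod_cast h3
            · positivity
    calc (P / q) ^ 2 * m ≤ (P / q) ^ 2 * ∑ t, (((f i t : ℕ) : ℝ) - ((f j t : ℕ) : ℝ)) ^ 2 := by
          gcongr
      _ = _ := by
          rw [Finset.mul_sum]
          exact Finset.sum_congr rfl fun t _ => by ring

end ColoredISIChannel

/-! ### Growth estimates -/

section Asymptotics

lemma eventually_mul_rpow_le_mul_rpow {a b : ℝ} (hab : a < b) (C : ℝ) {D : ℝ} (hD : 0 < D) :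
    ∀ᶠ n : ℕ in atTop, C * (n : ℝ) ^ a ≤ D * (n : ℝ) ^ b := by
  have h := (tendsto_rpow_atTop (sub_pos.2 hab)).comp tendsto_natCast_atTop_atTop
  filter_upwards [h.eventually_ge_atTop (C / D), eventually_ge_atTop 1] with n h1 hn
  have hn' : (0 : ℝ) < n := by exact_mod_cast hn
  simp only [Function.comp_apply] at h1
  rw [div_le_iff₀ hD] at h1
  have : (n : ℝ) ^ b = (n : ℝ) ^ (b - a) * (n : ℝ) ^ a := by
    rw [← Real.rpow_add hn']; ring_nf
  rw [this]
  have := mul_le_mul_of_nonneg_right h1 (Real.rpow_nonneg hn'.le a)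
  linarith

lemma two_rpow_mul_logb_mul {n : ℕ} (hn : 1 ≤ n) (R : ℝ) :
    (2 : ℝ) ^ (n * Real.logb 2 n * R) = ((n : ℝ) ^ R) ^ n := by
  have hn' : (0 : ℝ) < n := by exact_mod_cast hn
  rw [show (n : ℝ) * Real.logb 2 n * R = Real.logb 2 n * (R * n) by ring,
    Real.rpow_mul (by norm_num), Real.rpow_logb (by norm_num) (by norm_num) hn',
    Real.rpow_mul hn'.le, Real.rpow_natCast]

/-- The counting estimate behind the Gilbert–Varshamov bound for alphabets of size `n ^ α`. -/
lemma ceil_rpow_pow_mul_le {n q m : ℕ} {R α θ : ℝ} (hn : 1 ≤ n) (hR : 0 ≤ R) (hα : 0 ≤ α)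
    (hθ : θ ≤ 1) (hcount : 4 * (n : ℝ) ^ R ≤ (n : ℝ) ^ (α * (1 - θ)))
    (hqge : (n : ℝ) ^ α ≤ q) (hm : (m : ℝ) ≤ θ * n) :
    ⌈((n : ℝ) ^ R) ^ n⌉₊ * (2 ^ n * q ^ m) ≤ q ^ n := by
  have hn0 : (0 : ℝ) < n := by exact_mod_cast hn
  have hn1 : (1 : ℝ) ≤ n := by exact_mod_cast hn
  have hq1 : 1 ≤ (n : ℝ) ^ α := Real.one_le_rpow hn1 hα
  have hmn : m ≤ n := by
    have : (m : ℝ) ≤ n := hm.trans (mul_le_of_le_one_left hn0.le hθ)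
    exact_mod_cast this
  have hx : 1 ≤ ((n : ℝ) ^ R) ^ n := one_le_pow₀ (Real.one_le_rpow hn1 hR)
  -- Rounding up costs at most a factor `2 ^ n`; with the `2 ^ n` from the Hamming ball this gives
  -- the 4 in `hcount`.
  have hM : (⌈((n : ℝ) ^ R) ^ n⌉₊ : ℝ) ≤ 2 ^ n * ((n : ℝ) ^ R) ^ n := by
    have h1 := Nat.ceil_lt_add_one (zero_le_one.trans hx)
    have h2 : (2 : ℝ) ≤ 2 ^ n := by simpa using pow_le_pow_right₀ (one_le_two (α := ℝ)) hn
    have h3 := mul_le_mul_of_nonneg_right h2 (zero_le_one.trans hx)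
    linarith
  have hpow : 2 ^ n * ((n : ℝ) ^ R) ^ n * 2 ^ n ≤ (q : ℝ) ^ (n - m) := by
    calc 2 ^ n * ((n : ℝ) ^ R) ^ n * 2 ^ n = (4 * (n : ℝ) ^ R) ^ n := by
          rw [mul_right_comm, ← mul_pow, ← mul_pow]; norm_num
      _ ≤ ((n : ℝ) ^ (α * (1 - θ))) ^ n := by
          exact pow_le_pow_left₀ (by positivity) hcount n
      _ = ((n : ℝ) ^ α) ^ ((1 - θ) * n) := by
          rw [← Real.rpow_natCast, ← Real.rpow_mul hn0.le, ← Real.rpow_mul hn0.le, ← mul_assoc]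
      _ ≤ ((n : ℝ) ^ α) ^ (n - m) := by
          rw [← Real.rpow_natCast _ (n - m)]
          refine Real.rpow_le_rpow_of_exponent_le hq1 ?_
          rw [Nat.cast_sub hmn]
          linarith
      _ ≤ _ := pow_le_pow_left₀ (by positivity) hqge _
  have : (⌈((n : ℝ) ^ R) ^ n⌉₊ : ℝ) * (2 ^ n * q ^ m) ≤ q ^ n := by
    calc (⌈((n : ℝ) ^ R) ^ n⌉₊ : ℝ) * (2 ^ n * q ^ m)
        ≤ (2 ^ n * ((n : ℝ) ^ R) ^ n) * (2 ^ n * q ^ m) := by gcongr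
      _ = (2 ^ n * ((n : ℝ) ^ R) ^ n * 2 ^ n) * q ^ m := by ring
      _ ≤ (q : ℝ) ^ (n - m) * q ^ m := by gcongr
      _ = _ := by rw [← pow_add, Nat.sub_add_cancel hmn]
  exact_mod_cast this

end Asymptotics

/-! ### Achievable rates and the converse -/

namespace ColoredISIChannel

variable {G : ColoredISIChannel}

lemma eventually_sigmaMin_ge {μ : ℝ}
    (h : (fun n : ℕ => (n : ℝ) ^ (-μ)) =O[atTop] fun n : ℕ => G.sigmaMin n) :
    ∃ a : ℝ, 0 < a ∧ ∀ᶠ n : ℕ in atTop, a * (n : ℝ) ^ (-μ) ≤ G.sigmaMin n := by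
  obtain ⟨C, hC, hb⟩ := h.exists_pos
  refine ⟨C⁻¹, inv_pos.2 hC, ?_⟩
  filter_upwards [hb.bound] with n hn
  rw [Real.norm_of_nonneg (Real.rpow_nonneg (Nat.cast_nonneg _) _),
    Real.norm_of_nonneg (show 0 ≤ G.sigmaMin n from LinearMap.singularValues_nonneg _ _)] at hn
  rw [inv_mul_le_iff₀ hC]
  exact hn

lemma eventually_sigmaMax_le {s : ℝ}
    (h : (fun n : ℕ => G.sigmaMax n) =O[atTop] fun n : ℕ => (n : ℝ) ^ s) :
    ∃ B : ℝ, 0 < B ∧ ∀ᶠ n : ℕ in atTop, G.sigmaMax n ≤ B * (n : ℝ) ^ s := by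
  obtain ⟨C, hC, hb⟩ := h.exists_pos
  refine ⟨C, hC, ?_⟩
  filter_upwards [hb.bound] with n hn
  rw [Real.norm_of_nonneg (Real.rpow_nonneg (Nat.cast_nonneg _) _)] at hn
  exact (le_abs_self _).trans hn

lemma outLen_le_two_mul {n : ℕ} {κ : ℝ} (hn : 1 ≤ n) (hκ : κ ≤ 1)
    (hK : |(G.K n : ℝ) - (n : ℝ) ^ κ| < 1) : (G.outLen n : ℝ) ≤ 2 * n := by
  have hn1 : (1 : ℝ) ≤ n := by exact_mod_cast hn
  have h1 : (G.K n : ℝ) < n ^ κ + 1 := by linarith [lt_of_abs_lt hK]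
  have h2 : (n : ℝ) ^ κ ≤ n := by
    simpa using Real.rpow_le_rpow_of_exponent_le hn1 hκ
  have h3 : G.outLen n + 1 = n + G.K n := by simp only [outLen]; omega
  have h4 : (G.outLen n : ℝ) + 1 = n + G.K n := by exact_mod_cast h3
  linarith

/-- Rates below `(1 - 2 * (κ + μ)) / 4` are achievable. -/
theorem achievable_of_lt {P κ μ R : ℝ} (hP : 0 < P) (hκ : 0 ≤ κ) (hμ : 0 ≤ μ)
    (hK : ∀ n : ℕ, 1 ≤ n → |(G.K n : ℝ) - (n : ℝ) ^ κ| < 1) {c : ℝ} (hc : 0 < c)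
    (hdtft : ∀ n, 1 ≤ n → ∀ ω ∈ Set.Icc (-Real.pi) Real.pi, c ≤ ‖G.dtft n ω‖)
    (hmin : (fun n : ℕ => (n : ℝ) ^ (-μ)) =O[atTop] fun n : ℕ => G.sigmaMin n)
    (hmax : (fun n : ℕ => G.sigmaMax n) =O[atTop] fun n : ℕ => (n : ℝ) ^ (μ / 2))
    (hR : 0 < R) (hR' : R < (1 - 2 * (κ + μ)) / 4) : G.Achievable P R := by
  refine ⟨hR, fun e₁ he₁ e₂ he₂ => ?_⟩
  obtain ⟨a, ha, hmin⟩ := eventually_sigmaMin_ge hmin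
  obtain ⟨B, hB, hmax⟩ := eventually_sigmaMax_le hmax
  set V := Var[fun x : ℝ => x ^ 2; gaussianReal 0 1] with hV
  have hV0 : 0 ≤ V := variance_nonneg _ _
  set R₀ := (1 - 2 * (κ + μ)) / 4 with hR₀
  -- `α` lies strictly between `R` and `R₀`. `θ` is small enough that `α * (1 - θ)` still exceeds
  -- `R`, and `γ > 1/2` lets `δ = n ^ γ` beat the fluctuations of the squared norm while staying
  -- below the codeword separation.
  set α := (R + R₀) / 2 with hα
  set θ := (α - R) / (2 * α) with hθ
  set γ := 1 / 2 + (R₀ - α) with hγ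
  have hα0 : 0 < α := by linarith
  have hαR : R < α := by linarith
  have hθ0 : 0 < θ := div_pos (by linarith) (by linarith)
  have hθ1 : α * (1 - θ) = (R + α) / 2 := by
    rw [hθ]; field_simp; ring
  have hθlt : θ < 1 := by
    rw [hθ, div_lt_one (by linarith)]; linarith
  have hgap : γ + μ / 2 < 1 - 2 * α := by linarith
  filter_upwards [eventually_ge_atTop 1, hmin, hmax,
    (tendsto_natCast_atTop_atTop (R := ℝ)).eventually_ge_atTop (2 / θ),
    eventually_mul_rpow_le_mul_rpow (show R < (R + α) / 2 by linarith) 4 one_pos,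
    eventually_mul_rpow_le_mul_rpow hgap (3 * B) (D := c ^ 2 * P ^ 2 * θ / 8) (by positivity),
    eventually_mul_rpow_le_mul_rpow (show (1 : ℝ) < 2 * γ by linarith) (2 * V)
      (D := min e₁ (e₂ / 2)) (by positivity),
    eventually_mul_rpow_le_mul_rpow (show (0 : ℝ) < γ by linarith) 12
      (D := e₂ / 2) (by positivity)] with n hn hmin hmax hθn hcount hsep hchi hdel
  have hn0 : (0 : ℝ) < n := by exact_mod_cast hn
  have hn1 : (1 : ℝ) ≤ n := by exact_mod_cast hn
  have hq1 : 1 ≤ (n : ℝ) ^ α := Real.one_le_rpow hn1 hα0.le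
  have hqle : (⌈(n : ℝ) ^ α⌉₊ : ℝ) ≤ 2 * (n : ℝ) ^ α := by
    linarith [Nat.ceil_lt_add_one (zero_le_one.trans hq1)]
  have hqge : (n : ℝ) ^ α ≤ ⌈(n : ℝ) ^ α⌉₊ := Nat.le_ceil _
  have hθn2 : 2 ≤ θ * n := by rwa [div_le_iff₀' hθ0] at hθn
  have hmle : (⌊θ * n⌋₊ : ℝ) ≤ θ * n := Nat.floor_le (by positivity)
  have hmge : θ * n / 2 ≤ ⌊θ * n⌋₊ := by linarith [Nat.lt_floor_add_one (θ * n)]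
  set q := ⌈(n : ℝ) ^ α⌉₊
  set m := ⌊θ * n⌋₊
  have hq : 1 ≤ q := by exact_mod_cast hq1.trans hqge
  have hq0 : (0 : ℝ) < q := by exact_mod_cast hq
  set δ := (n : ℝ) ^ γ with hδ
  have hδ0 : 0 < δ := Real.rpow_pos_of_pos hn0 _
  have hδ2 : δ ^ 2 = (n : ℝ) ^ (2 * γ) := by
    rw [hδ, ← Real.rpow_natCast, ← Real.rpow_mul hn0.le]; norm_num [mul_comm]
  have hout := outLen_le_two_mul hn (by linarith) (hK n hn)
  have hchi' : G.outLen n * V / δ ^ 2 ≤ min e₁ (e₂ / 2) := by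
    rw [div_le_iff₀ (by positivity), hδ2]
    rw [Real.rpow_one] at hchi
    exact (mul_le_mul_of_nonneg_right hout hV0).trans (by linarith)
  have hdel' : 12 / δ ≤ e₂ / 2 := by
    rw [div_le_iff₀ hδ0]
    simpa using hdel
  refine nonempty_DICode (b := B * (n : ℝ) ^ (μ / 2)) (δ := δ) (q := q) (m := m) hn hP
    (lt_of_lt_of_le (by positivity) hmin) hc.le (hdtft n hn) (by positivity) hmax hδ0 hq
    ?_ ?_ (hchi'.trans (min_le_left _ _))
    (by linarith [hchi'.trans (min_le_right e₁ (e₂ / 2))])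
  · rw [two_rpow_mul_logb_mul hn]
    rw [one_mul, ← hθ1] at hcount
    exact ceil_rpow_pow_mul_le hn hR.le hα0.le hθlt.le hcount hqge hmle
  · have h1 : 3 * δ * (B * (n : ℝ) ^ (μ / 2)) = 3 * B * (n : ℝ) ^ (γ + μ / 2) := by
      rw [Real.rpow_add hn0]; ring
    rw [h1]
    refine hsep.trans ?_
    have h2 : (n : ℝ) ^ (1 - 2 * α) = n / ((n : ℝ) ^ α) ^ 2 := by
      rw [Real.rpow_sub hn0, Real.rpow_one, ← Real.rpow_natCast, ← Real.rpow_mul hn0.le]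
      norm_num [mul_comm]
    rw [h2]
    -- The 8 collects `q ≤ 2 * n ^ α`, squared, and `m ≥ θ * n / 2`.
    calc c ^ 2 * P ^ 2 * θ / 8 * (n / ((n : ℝ) ^ α) ^ 2)
        = c ^ 2 * ((P / (2 * (n : ℝ) ^ α)) ^ 2 * (θ * n / 2)) := by
          field_simp; ring
      _ ≤ _ := by gcongr

/-- Achievable rates are at most `1 / 2 + κ + μ / 2`. -/
theorem le_of_achievable {P κ μ R : ℝ} (hP : 0 < P) (hκ : 0 ≤ κ)
    (hK : ∀ n : ℕ, 1 ≤ n → |(G.K n : ℝ) - (n : ℝ) ^ κ| < 1)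
    {L : ℝ} (hL : ∀ n, 1 ≤ n → ∀ k < G.K n, |G.h n k| ≤ L)
    (hmin : (fun n : ℕ => (n : ℝ) ^ (-μ)) =O[atTop] fun n : ℕ => G.sigmaMin n)
    (hR : G.Achievable P R) : R ≤ 1 / 2 + κ + μ / 2 := by
  by_contra! hcon
  obtain ⟨a, ha, hmin⟩ := eventually_sigmaMin_ge hmin
  set β := 1 / 2 + κ + μ / 2 with hβ
  have hL1 : 0 < max L 1 := lt_max_of_lt_right one_pos
  set L' := max L 1
  -- Chosen so that `4 * (L' * ρ) ^ 2 = a / 16`, the 4 coming from `K ≤ 2 * n ^ κ`.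
  set ρ := √a / (8 * L') with hρ
  have hρ0 : 0 < ρ := by positivity
  have hev := (hR.2 (1 / 4) (by norm_num) (1 / 4) (by norm_num)).and
    (eventually_mul_rpow_le_mul_rpow hcon (2 * P / ρ) (D := 1 / 4) (by norm_num))
  have hR0 := hR.1
  obtain ⟨n, ⟨⟨C⟩, hlt⟩, hmin, hn, hn4⟩ := (hev.and (hmin.and ((eventually_ge_atTop 1).and
    (eventually_mul_rpow_le_mul_rpow hR0 2 one_pos)))).exists
  have hn0 : (0 : ℝ) < n := by exact_mod_cast hn
  have hn1 : (1 : ℝ) ≤ n := by exact_mod_cast hn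
  have hKle : (G.K n : ℝ) ≤ 2 * (n : ℝ) ^ κ := by
    linarith [lt_of_abs_lt (hK n hn), Real.one_le_rpow hn1 hκ]
  rw [two_rpow_mul_logb_mul hn] at C
  have hr0 : 0 < ρ * (n : ℝ) ^ (-β) := by positivity
  have hcard := C.card_le hn (lt_of_lt_of_le (by positivity) hmin) hL1.le
    (fun k hk => (hL n hn k hk).trans (le_max_left _ _)) hr0 (by
      calc (G.K n * L') ^ 2 * (n * (ρ * (n : ℝ) ^ (-β)) ^ 2)
          ≤ (2 * (n : ℝ) ^ κ * L') ^ 2 * (n * (ρ * (n : ℝ) ^ (-β)) ^ 2) := by gcongr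
        _ = 4 * (L' * ρ) ^ 2 * (((n : ℝ) ^ κ) ^ 2 * n * ((n : ℝ) ^ (-β)) ^ 2) := by ring
        _ = a / 16 * (n : ℝ) ^ (-μ) := by
            have h1 : L' * ρ = √a / 8 := by rw [hρ]; field_simp
            have h2 : ((n : ℝ) ^ κ) ^ 2 * n * ((n : ℝ) ^ (-β)) ^ 2 = (n : ℝ) ^ (-μ) := by
              rw [← Real.rpow_natCast, ← Real.rpow_natCast, ← Real.rpow_mul hn0.le,
                ← Real.rpow_mul hn0.le, ← Real.rpow_add_one hn0.ne', ← Real.rpow_add hn0]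
              congr 1
              rw [hβ]; push_cast; ring
            rw [h1, h2, div_pow, Real.sq_sqrt ha.le]
            ring
        _ ≤ _ := by linarith)
  have hcast : (⌈((n : ℝ) ^ R) ^ n⌉₊ : ℝ) ≤ ((⌊2 * P / (ρ * (n : ℝ) ^ (-β))⌋₊ : ℝ) + 1) ^ n := by
    exact_mod_cast hcard
  have h1 : (n : ℝ) ^ R ≤ (⌊2 * P / (ρ * (n : ℝ) ^ (-β))⌋₊ : ℝ) + 1 :=
    le_of_pow_le_pow_left₀ (by omega) (by positivity) ((Nat.le_ceil _).trans hcast)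
  have h2 := Nat.floor_le (show 0 ≤ 2 * P / (ρ * (n : ℝ) ^ (-β)) by positivity)
  have h3 : 2 * P / (ρ * (n : ℝ) ^ (-β)) = 2 * P / ρ * (n : ℝ) ^ β := by
    rw [Real.rpow_neg hn0.le]; field_simp
  rw [Real.rpow_zero] at hn4
  rw [h3] at h1 h2
  -- The floor is at most a quarter of `n ^ R` and the added 1 at most half of it, so `n ^ R ≤ (3/4)
  -- * n ^ R`.
  linarith

end ColoredISIChannel

theorem theorem1 (G : ColoredISIChannel) (P κ μ : ℝ) (hP : 0 < P)
    (hκ : 0 ≤ κ) (hμ : 0 ≤ μ) (hκμ : κ + μ < 1 / 2)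
    -- the number of taps is `n ^ κ`, rounded to an integer in either direction
    (hK : ∀ n : ℕ, 1 ≤ n → |(G.K n : ℝ) - (n : ℝ) ^ κ| < 1)
    -- the taps are bounded
    (hC1 : ∃ L : ℝ, ∀ n, 1 ≤ n → ∀ k < G.K n, |G.h n k| ≤ L)
    -- the frequency response is bounded away from zero
    (hC2 : ∃ c : ℝ, 0 < c ∧ ∀ n, 1 ≤ n → ∀ ω ∈ Set.Icc (-Real.pi) Real.pi, c ≤ ‖G.dtft n ω‖)
    -- the smallest singular value is in `Ω(n ^ (-μ))`, the largest one in `O(n ^ (μ / 2))`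
    (hC3min : (fun n : ℕ => (n : ℝ) ^ (-μ)) =O[atTop] fun n : ℕ => G.sigmaMin n)
    (hC3max : (fun n : ℕ => G.sigmaMax n) =O[atTop] fun n : ℕ => (n : ℝ) ^ (μ / 2)) :
    (((1 - 2 * (κ + μ)) / 4 : ℝ) : EReal) ≤ G.capacity P ∧
      G.capacity P ≤ ((1 + κ + μ / 2 : ℝ) : EReal) := by
  obtain ⟨L, hL⟩ := hC1
  obtain ⟨c, hc, hdtft⟩ := hC2
  constructor
  · refine le_of_forall_lt_imp_le_of_dense fun r hr => ?_
    have hpos : (0 : ℝ) < (1 - 2 * (κ + μ)) / 4 := by linarith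
    -- The maximum with 0 makes the intermediate rate positive, as achievability demands.
    obtain ⟨R, hR1, hR2⟩ := EReal.lt_iff_exists_real_btwn.1
      (max_lt hr (EReal.coe_lt_coe_iff.2 hpos))
    have hR0 : 0 < R := EReal.coe_lt_coe_iff.1 ((le_max_right _ _).trans_lt hR1)
    refine ((le_max_left _ _).trans hR1.le).trans (le_sSup ⟨R, ?_, rfl⟩)
    exact ColoredISIChannel.achievable_of_lt hP hκ hμ hK hc hdtft hC3min hC3max hR0
      (EReal.coe_lt_coe_iff.1 hR2)
  · refine sSup_le ?_
    rintro _ ⟨R, hR, rfl⟩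
    have := ColoredISIChannel.le_of_achievable hP hκ hK hL hC3min hR
    exact EReal.coe_le_coe_iff.2 (by linarith)
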